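/- A *network* is a finite acyclic directed multigraph $G=(V,E)$ with a source node $s\in V$ that has no incoming channels. The elements of $E$ are called channels; each has unit capacity and leads from $\mathrm{tail}(e)$ to $\mathrm{head}(e)$. For a set $T$ of non-source nodes, $C_T$ (written $C_t$ if $T=\{t\}$) is the least number of channels whose removal disconnects $s$ from every $t\in T$. For a nonempty set $\xi\subseteq E$ of channels, $C_\xi$ is the minimum cut capacity $C_{\{n_e:\,e\in\xi\}}$ in the network obtained from $G$ by replacing every $e=(i,j)\in\xi$ by a new node $n_e$ and two channels $(i,n_e)$, $(n_e,j)$. Let $\omega\ge 1$ be an integer and $\mathcal F$ a field. Let $In(s)=\{d_1',\dots,d_\omega'\}$ consist of $\omega$ imaginary message channels, and for a node $i\ne s$ let $In(i)$ be the set of channels with head $i$. An *$\omega$-dimensional $\mathcal F$-valued linear network error correction (LNEC) code* on $G$ is given by local encoding coefficients $k_{d,e}\in\mathcal F$ ($e\in E$, $d\in In(\mathrm{tail}(e))$) and column vectors $\tilde f_e\in\mathcal F^{In(s)\cup E}$ ($e\in E$) with $$\tilde f_e=\sum_{d\in In(\mathrm{tail}(e))}k_{d,e}\tilde f_d+1_e,\qquad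 \tilde f_{d_i'}=1_{d_i'}\quad(1\le i\le\omega),$$ where $1_d$ is the indicator vector of $d$. For a nonempty $\xi\subseteq E$ and $d\in In(s)\cup E$ put $\mathrm{row}_\xi(d)=[\tilde f_e(d):e\in\xi]\in\mathcal F^{\xi}$, and for $\rho\subseteq E$ let $$\Phi(\xi)=\langle \mathrm{row}_\xi(d_i'):1\le i\le\omega\rangle,\qquad \Delta(\xi,\rho)=\langle \mathrm{row}_\xi(e):e\in\rho\rangle,$$ $$d_{\min}^{(\xi)}=\min\{|\rho|:\ \rho\subseteq E,\ \Delta(\xi,\rho)\cap\Phi(\xi)\ne\{0\}\}.$$ The code is an *LNEC generic MDS code* if for every nonempty $\xi\subseteq E$ it satisfies $\dim\Phi(\xi)=\min\{\omega,C_\xi\}$ (that is, it is channel-regular) and $$d_{\min}^{(\xi)}=\begin{cases}C_\xi-\omega+1&\text{if }C_\xi\ge\omega,\\ 1&\text{if }0<C_\xi<\omega.\end{cases}$$ (If $C_\xi=0$, no channel of $\xi$ can be reached from $s$, $\Phi(\xi)=\{0\}$, and $d_{\min}^{(\xi)}$ is not defined.) **Theorem.** Let $G=(V,E)$ be a network and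 let $G'$ be the network obtained from it by replacing every channel $e=(i,j)\in E$ by a new node $n_e$ and two channels $(i,n_e)$, $(n_e,j)$. Let $\mathcal T$ be the set of all nonempty sets of non-source nodes of $G'$. If $$|\mathcal F|>\sum_{T\in\mathcal T:\ C_T\ge\omega}\binom{2|E|+\sum_{S\in\mathcal T}\sum_{t\in S}C_t}{C_T-\omega}+\bigl|\{T\in\mathcal T:\ C_T<\omega\}\bigr|,$$ where all minimum cut capacities are taken in $G'$, then there is an $\omega$-dimensional $\mathcal F$-valued LNEC generic MDS code on $G$. -/

import Mathlib

/-- A directed multigraph with node set `V`, channel set `E` (every channel has unit capacity)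
and a distinguished source node. -/
structure Network (V E : Type*) where
  /-- the node from which a channel leaves -/
  tail : E → V
  /-- the node to which a channel leads -/
  head : E → V
  /-- the source node -/
  source : V

namespace Network

variable {V E : Type*}

/-- `G.Step A i j`: some channel outside `A` leads from `i` to `j`. -/
def Step (G : Network V E) (A : Finset E) (i j : V) : Prop :=
  ∃ e, e ∉ A ∧ G.tail e = i ∧ G.head e = j

/-- There is no directed cycle. -/
def Acyclic (G : Network V E) : Prop :=
  ∀ v, ¬ Relation.TransGen (G.Step ∅) v v

/-- The removal of the channels in `A` disconnects the source from all nodes in `T`. -/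
def IsCut (G : Network V E) (T : Finset V) (A : Finset E) : Prop :=
  ∀ t ∈ T, ¬ Relation.ReflTransGen (G.Step A) G.source t

/-- The minimum cut capacity `C_T` between the source and a collection `T` of non-source nodes. -/
noncomputable def minCut (G : Network V E) (T : Finset V) : ℕ :=
  sInf {n | ∃ A : Finset E, G.IsCut T A ∧ A.card = n}

/-- Every channel `e = (i, j)` in `ξ` is replaced by a new node `n_e` (the node `Sum.inr e`) and two
channels `(i, n_e)` and `(n_e, j)` (the channels `Sum.inr (Sum.inl e)` and
`Sum.inr (Sum.inr e)`); the channels outside `ξ` are kept. -/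
def subdivide (G : Network V E) (ξ : Finset E) :
    Network (V ⊕ {e // e ∈ ξ}) ({e // e ∉ ξ} ⊕ ({e // e ∈ ξ} ⊕ {e // e ∈ ξ})) where
  tail := Sum.elim (fun e => Sum.inl (G.tail e))
    (Sum.elim (fun e => Sum.inl (G.tail e)) (fun e => Sum.inr e))
  head := Sum.elim (fun e => Sum.inl (G.head e))
    (Sum.elim (fun e => Sum.inr e) (fun e => Sum.inl (G.head e)))
  source := Sum.inl G.source

/-- The minimum cut capacity `C_ξ` between the source and a collection `ξ` of channels: the minimum
cut capacity between the source and `{n_e : e ∈ ξ}` after subdividing the channels in `ξ`. -/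
noncomputable def chanMinCut (G : Network V E) (ξ : Finset E) : ℕ :=
  (G.subdivide ξ).minCut (Finset.univ.map Function.Embedding.inr)

/-- The nonempty collections of non-source nodes. -/
noncomputable def collections [Fintype V] (G : Network V E) : Finset (Finset V) :=
  open Classical in
  Finset.univ.filter fun T => T.Nonempty ∧ G.source ∉ T

/-- The bound on the field size, over the network `G'` in which every channel of `G` is
subdivided:
`∑_{T : C_T ≥ ω} (2|E| + ∑_T ∑_{t ∈ T} C_t).choose (C_T - ω) + |{T : C_T < ω}|`,
where `T` runs over the nonempty collections of non-source nodes of `G'`. -/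
noncomputable def fieldBound [Fintype V] [Fintype E] (G : Network V E) (ω : ℕ) : ℕ :=
  open Classical in
  let G' := G.subdivide Finset.univ
  ∑ T ∈ G'.collections.filter (fun T => ω ≤ G'.minCut T),
      (2 * Fintype.card E + ∑ S ∈ G'.collections, ∑ t ∈ S, G'.minCut {t}).choose
        (G'.minCut T - ω)
    + (G'.collections.filter (fun T => G'.minCut T < ω)).card

/-- The channels of `G` together with the `ω` imaginary message channels `d'_1, …, d'_ω`, which
enter the source. -/
abbrev ExtChan (E : Type*) (ω : ℕ) : Type _ := Fin ω ⊕ E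

/-- The head of a channel or imaginary message channel. -/
def extHead (G : Network V E) {ω : ℕ} : ExtChan E ω → V :=
  Sum.elim (fun _ => G.source) G.head

/-- `In(i)`, where the `ω` imaginary message channels enter the source. -/
noncomputable def In [Fintype E] (G : Network V E) (ω : ℕ) (i : V) : Finset (ExtChan E ω) :=
  open Classical in
  Finset.univ.filter fun d => G.extHead d = i

/-- The column vector `1_d`, the indicator function of `d`. -/
noncomputable def unitKernel {F : Type*} [Field F] {ω : ℕ} (d : ExtChan E ω) : ExtChan E ω → F :=
  Set.indicator {d} fun _ => 1

/-- The extended global encoding kernels of all channels and imaginary message channels, when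
`f` gives those of the channels: the imaginary message channels have indicator vectors. -/
noncomputable def extKernel {F : Type*} [Field F] {ω : ℕ} (f : E → ExtChan E ω → F) :
    ExtChan E ω → ExtChan E ω → F :=
  Sum.elim (fun i => unitKernel (Sum.inl i)) f

end Network

open Network

/-- An `ω`-dimensional `F`-valued linear network error correction code on `G`: local encoding
coefficients `k d e` (of which only those of adjacent pairs, `d ∈ In (tail e)`, play a role)
together with the extended global encoding kernels, with entries indexed by the
imaginary message channels and the channels. The imaginary error channel of `e` has the
indicator vector of `e` as its kernel and contributes the last summand of the recursion. -/
structure LNECCode {V E : Type*} [Fintype E] (G : Network V E) (F : Type*) [Field F] (ω : ℕ) where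
  /-- local encoding coefficients -/
  k : ExtChan E ω → E → F
  /-- extended global encoding kernels -/
  f : E → ExtChan E ω → F
  /-- `f e = ∑_{d ∈ In (tail e)} k d e • f d + 1_e` -/
  f_eq : ∀ e, f e = ∑ d ∈ G.In ω (G.tail e), k d e • extKernel f d + unitKernel (Sum.inr e)

namespace LNECCode

variable {V E : Type*} [Fintype E] {G : Network V E} {F : Type*} [Field F] {ω : ℕ}

/-- The row of the decoding matrix `[f e : e ∈ ξ]` indexed by `d`. -/
def row (K : LNECCode G F ω) (ξ : Finset E) (d : ExtChan E ω) : {e // e ∈ ξ} → F :=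
  fun e => K.f e d

/-- The message space `Φ(ξ)`. -/
def msgSpace (K : LNECCode G F ω) (ξ : Finset E) : Submodule F ({e // e ∈ ξ} → F) :=
  Submodule.span F (Set.range fun i : Fin ω => K.row ξ (Sum.inl i))

/-- The error space `Δ(ξ, ρ)` of the error pattern `ρ`. -/
def errSpace (K : LNECCode G F ω) (ξ ρ : Finset E) : Submodule F ({e // e ∈ ξ} → F) :=
  Submodule.span F ((fun e => K.row ξ (Sum.inr e)) '' (ρ : Set E))

/-- The minimum distance at `ξ`, the minimum of `|ρ|` over the error patterns `ρ` with
`Δ(ξ, ρ) ∩ Φ(ξ) ≠ {0}` (it is `⊤` if there is no such `ρ`). The two other usual expressions agree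
with it, see `minDist_eq_rank` and `minDist_eq_dim`. -/
noncomputable def minDist (K : LNECCode G F ω) (ξ : Finset E) : ℕ∞ :=
  ⨅ (ρ : Finset E) (_ : K.errSpace ξ ρ ⊓ K.msgSpace ξ ≠ ⊥), (ρ.card : ℕ∞)

/-- Channel-regular codes, also called LNEC generic codes. -/
def IsGeneric (K : LNECCode G F ω) : Prop :=
  ∀ ξ : Finset E, ξ.Nonempty → Module.finrank F (K.msgSpace ξ) = min ω (G.chanMinCut ξ)

/-- LNEC generic MDS codes: channel-regular codes whose minimum distance at every nonempty `ξ` is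
`C_ξ - ω + 1` if `C_ξ ≥ ω` and `1` if `C_ξ < ω`. If `C_ξ = 0`, that is, if no channel in `ξ` can be
reached from the source, then `Φ(ξ) = {0}` and there is no minimum distance to speak of. -/
def IsGenericMDS (K : LNECCode G F ω) : Prop :=
  K.IsGeneric ∧ ∀ ξ : Finset E, ξ.Nonempty →
    (ω ≤ G.chanMinCut ξ → K.minDist ξ = ((G.chanMinCut ξ - ω + 1 : ℕ) : ℕ∞)) ∧
    (0 < G.chanMinCut ξ → G.chanMinCut ξ < ω → K.minDist ξ = 1)

/-- `ρ₁` is dominated by `ρ₂` with respect to `ξ`. -/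
def Dominated (G : Network V E) (F : Type*) [Field F] (ω : ℕ) (ξ ρ₁ ρ₂ : Finset E) : Prop :=
  ∀ K : LNECCode G F ω, K.errSpace ξ ρ₁ ≤ K.errSpace ξ ρ₂

/-- The rank of an error pattern with respect to `ξ`. -/
noncomputable def patternRank (G : Network V E) (F : Type*) [Field F] (ω : ℕ) (ξ ρ : Finset E) : ℕ :=
  sInf {n | ∃ ρ' : Finset E, Dominated G F ω ξ ρ ρ' ∧ ρ'.card = n}

theorem minDist_eq_rank (K : LNECCode G F ω) (ξ : Finset E) :
    K.minDist ξ = ⨅ (ρ : Finset E) (_ : K.errSpace ξ ρ ⊓ K.msgSpace ξ ≠ ⊥),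
      (patternRank G F ω ξ ρ : ℕ∞) := by
  apply le_antisymm
  · refine le_iInf₂ fun ρ hρ => ?_
    obtain ⟨ρ', hd, hc⟩ := Nat.sInf_mem (s := {n | ∃ ρ' : Finset E,
      Dominated G F ω ξ ρ ρ' ∧ ρ'.card = n}) ⟨_, ρ, fun _ => le_rfl, rfl⟩
    have h' : K.errSpace ξ ρ' ⊓ K.msgSpace ξ ≠ ⊥ := fun h =>
      hρ (le_bot_iff.1 (h ▸ inf_le_inf_right _ (hd K)))
    unfold patternRank
    rw [← hc]
    exact iInf₂_le ρ' h'
  · refine le_iInf₂ fun ρ hρ => (iInf₂_le ρ hρ).trans ?_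
    have h : patternRank G F ω ξ ρ ≤ ρ.card := Nat.sInf_le ⟨ρ, fun _ => le_rfl, rfl⟩
    exact_mod_cast h

theorem minDist_eq_dim (K : LNECCode G F ω) (ξ : Finset E) :
    K.minDist ξ = ⨅ (ρ : Finset E) (_ : K.errSpace ξ ρ ⊓ K.msgSpace ξ ≠ ⊥),
      (Module.finrank F (K.errSpace ξ ρ) : ℕ∞) := by
  classical
  apply le_antisymm
  · refine le_iInf₂ fun ρ hρ => ?_
    obtain ⟨b, hb, hspan, hli⟩ := exists_linearIndependent F
      ((fun e => K.row ξ (Sum.inr e)) '' (ρ : Set E))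
    obtain ⟨ρ', hsub, hbij⟩ := (Set.SurjOn.exists_bijOn_subset
      (f := fun e => K.row ξ (Sum.inr e)) (s := (ρ : Set E)) (t := b) hb)
    have hfin : ρ'.Finite := ρ.finite_toSet.subset hsub
    have hsp : K.errSpace ξ hfin.toFinset = K.errSpace ξ ρ := by
      unfold errSpace
      rw [hfin.coe_toFinset, hbij.image_eq, hspan]
    have hbfin : b.Finite := hbij.image_eq ▸ hfin.image _
    have := hbfin.fintype
    have hcard : Module.finrank F (K.errSpace ξ ρ) = hfin.toFinset.card := by
      have h1 := finrank_span_set_eq_card (R := F) hli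
      unfold errSpace
      rw [← hspan, h1, ← Set.ncard_eq_toFinset_card', ← hbij.ncard_eq,
        Set.ncard_eq_toFinset_card _ hfin]
    rw [hcard]
    exact iInf₂_le hfin.toFinset (by rwa [hsp])
  · refine le_iInf₂ fun ρ hρ => (iInf₂_le ρ hρ).trans ?_
    have h := finrank_span_finset_le_card (R := F) (ρ.image fun e => K.row ξ (Sum.inr e))
    have h2 := h.trans Finset.card_image_le
    rw [Set.finrank, Finset.coe_image] at h2
    exact_mod_cast h2

end LNECCode

/-! Write $N$ for the matrix of local encoding coefficients. It is nilpotent since $G$ is acyclic,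
and the kernels are the columns of $(1-N)^{-1}$. Equivalently, the row of $d$ is the combination of
the rows of the channels following $d$, with coefficients $k_{d,e}$, plus a unit vector if
$d\in\xi$. Independence of rows is witnessed by a minor, which up to a nonzero factor is a
polynomial of degree at most 1 in each coefficient. Hence rows that are independent for one choice
of coefficients, even over an extension field, are independent for algebraically independent
("generic") coefficients.

Generically the channels leaving the source have rank at least $C_\xi$ (`chanCutNum_le_finrank`).
This is a greedy max-flow min-cut argument: if the row of $d$ depends on rows that are not lower
than $d$, so do the rows of all successors of $d$ (`mem_span_of_genericCoeff`). Dependent channels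
can thus be traded for their successors, and those that are never traded form a cut
(`exists_separation`).

Fix $\xi$ and $\rho$ with $|\rho|=\max(C_\xi-\omega,0)$. A generic basis $\rho_0$ of the rows of
$\rho$ extends by channels leaving the source to $C_\xi$ or more independent rows, so
$\min(\omega,C_\xi)$ messages can be sent along the added channels. The resulting minor is a nonzero
polynomial, and wherever it does not vanish, messages and errors are separated
(`exists_separating_polynomial`). The pairs $(\xi,\rho)$ are no more numerous than the field bound,
so one point serves all of them (`MvPolynomial.exists_forall_eval_ne_zero`). This bounds the
distances from below; the Singleton bound at a minimum cut bounds them from above. -/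

namespace Network

/-! ### Kernels as the inverse of a unipotent matrix -/

section Kernels

open scoped Classical

variable {V E S : Type*} [CommRing S] (G : Network V E) {ω : ℕ}

/-- A function on the channels that increases along adjacent pairs of channels. -/
def IsHeight (h : ExtChan E ω → ℕ) : Prop :=
  ∀ d e, G.extHead d = G.tail e → h d < h (Sum.inr e)

/-- An acyclic network has a height function. -/
theorem Acyclic.exists_isHeight [Fintype V] {G : Network V E} (hG : G.Acyclic) (ω : ℕ) :
    ∃ h : ExtChan E ω → ℕ, G.IsHeight h := by
  let n : V → ℕ := fun v => (Finset.univ.filter fun u => Relation.TransGen (G.Step ∅) u v).card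
  -- The summand 1 lifts every channel above the message channels, which have height 0.
  refine ⟨Sum.elim (fun _ => 0) fun e => n (G.tail e) + 1, ?_⟩
  rintro (i | d) e hde
  · simp
  · simp only [Sum.elim_inr, add_lt_add_iff_right]
    have hstep : G.Step ∅ (G.tail d) (G.tail e) := ⟨d, by simp, rfl, hde⟩
    refine Finset.card_lt_card ⟨fun u hu => ?_, fun hsub => ?_⟩
    · simp only [Finset.mem_filter, Finset.mem_univ, true_and] at hu ⊢
      exact hu.tail hstep
    · have : G.tail d ∈ Finset.univ.filter fun u => Relation.TransGen (G.Step ∅) u (G.tail e) := by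
        simpa using Relation.TransGen.single hstep
      have := hsub this
      simp only [Finset.mem_filter, Finset.mem_univ, true_and] at this
      exact hG _ this

/-- The matrix of local encoding coefficients of adjacent pairs. -/
noncomputable def encMatrix (k : ExtChan E ω → E → S) :
    Matrix (ExtChan E ω) (ExtChan E ω) S :=
  Matrix.of fun d => Sum.elim 0 fun e => if G.extHead d = G.tail e then k d e else 0

@[simp] theorem encMatrix_inl (k : ExtChan E ω → E → S) (d : ExtChan E ω) (i : Fin ω) :
    G.encMatrix k d (Sum.inl i) = 0 := rfl

@[simp] theorem encMatrix_inr (k : ExtChan E ω → E → S) (d : ExtChan E ω) (e : E) :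
    G.encMatrix k d (Sum.inr e) = if G.extHead d = G.tail e then k d e else 0 := rfl

variable {G} in
theorem IsHeight.lt_of_encMatrix_ne_zero {h : ExtChan E ω → ℕ} (hh : G.IsHeight h)
    {k : ExtChan E ω → E → S} {d e : ExtChan E ω} (hde : G.encMatrix k d e ≠ 0) : h d < h e := by
  rcases e with i | e
  · simp at hde
  · rw [encMatrix_inr] at hde
    exact hh d e (by by_contra hn; simp [hn] at hde)

variable [Fintype E]

variable {G} in
-- A nonzero entry of the `n`-th power belongs to a path of `n` steps, each of which raises the
-- height.
theorem IsHeight.isNilpotent_encMatrix {h : ExtChan E ω → ℕ} (hh : G.IsHeight h)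
    (k : ExtChan E ω → E → S) : IsNilpotent (G.encMatrix k) := by
  have key : ∀ n d e, (G.encMatrix k ^ n) d e ≠ 0 → h d + n ≤ h e := by
    intro n
    induction n with
    | zero =>
      intro d e hne
      rw [pow_zero, Matrix.one_apply] at hne
      have : d = e := by by_contra hn; simp [hn] at hne
      simp [this]
    | succ n ih =>
      intro d e hne
      rw [pow_succ, Matrix.mul_apply] at hne
      obtain ⟨b, -, hb⟩ := Finset.exists_ne_zero_of_sum_ne_zero hne
      have h1 := ih d b (left_ne_zero_of_mul hb)
      have h2 := hh.lt_of_encMatrix_ne_zero (right_ne_zero_of_mul hb)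
      omega
  refine ⟨Finset.univ.sup h + 1, ?_⟩
  ext d e
  by_contra hne
  have h1 := key _ d e hne
  have h2 : h e ≤ Finset.univ.sup h := Finset.le_sup (Finset.mem_univ e)
  omega

/-- The matrix whose columns are the extended global encoding kernels. -/
noncomputable def kerMatrix (k : ExtChan E ω → E → S) : Matrix (ExtChan E ω) (ExtChan E ω) S :=
  (1 - G.encMatrix k)⁻¹

/-- The row indexed by `d` of the matrix of global encoding kernels of the channels in `ξ`. -/
noncomputable def kerRow (k : ExtChan E ω → E → S) (ξ : Finset E) (d : ExtChan E ω) :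
    {e // e ∈ ξ} → S :=
  fun e => G.kerMatrix k d (Sum.inr e)

variable {G} {h : ExtChan E ω → ℕ} (hh : G.IsHeight h)
include hh

theorem IsHeight.isUnit_det (k : ExtChan E ω → E → S) : IsUnit (1 - G.encMatrix k).det :=
  (Matrix.isUnit_iff_isUnit_det _).1 (hh.isNilpotent_encMatrix k).isUnit_one_sub

theorem IsHeight.kerMatrix_eq_enc_mul (k : ExtChan E ω → E → S) :
    G.kerMatrix k = G.encMatrix k * G.kerMatrix k + 1 := by
  have h1 : (1 - G.encMatrix k) * G.kerMatrix k = 1 := Matrix.mul_nonsing_inv _ (hh.isUnit_det k)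
  rw [← h1, sub_mul, one_mul, add_sub_cancel]

theorem IsHeight.kerMatrix_eq_mul_enc (k : ExtChan E ω → E → S) :
    G.kerMatrix k = G.kerMatrix k * G.encMatrix k + 1 := by
  have h1 : G.kerMatrix k * (1 - G.encMatrix k) = 1 := Matrix.nonsing_inv_mul _ (hh.isUnit_det k)
  rw [← h1, mul_sub, mul_one, add_sub_cancel]

theorem IsHeight.kerRow_eq (k : ExtChan E ω → E → S) (ξ : Finset E) (d : ExtChan E ω) :
    G.kerRow k ξ d = ∑ e with G.extHead d = G.tail e, k d e • G.kerRow k ξ (Sum.inr e) +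
      fun e => if d = Sum.inr e.1 then 1 else 0 := by
  ext e
  unfold kerRow
  rw [congrFun (congrFun (hh.kerMatrix_eq_enc_mul k) d) (Sum.inr e.1)]
  simp [Matrix.add_apply, Matrix.mul_apply, Matrix.one_apply, Finset.sum_filter, ite_mul,
    Finset.sum_apply, ite_apply]

/-- The entry sums over the paths from `c` to `d`, and a nontrivial path would raise the height. -/
theorem IsHeight.kerMatrix_apply_eq_zero (k : ExtChan E ω → E → S) {c d : ExtChan E ω}
    (hcd : c ≠ d) (hle : h d ≤ h c) : G.kerMatrix k c d = 0 := by
  induction hn : h d using Nat.strong_induction_on generalizing d with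
  | _ n ih =>
    rw [hh.kerMatrix_eq_mul_enc k, Matrix.add_apply, Matrix.one_apply_ne hcd, add_zero,
      Matrix.mul_apply]
    refine Finset.sum_eq_zero fun b _ => ?_
    by_cases hb : G.encMatrix k b d = 0
    · rw [hb, mul_zero]
    · have hlt := hh.lt_of_encMatrix_ne_zero hb
      rw [ih (h b) (hn ▸ hlt) (fun hcb => by subst hcb; omega) (by omega) rfl, zero_mul]

/-- A row feels only the coefficients at places it reaches. This is read off the resolvent identity
$K-K'=K(N-N')K'$. -/
theorem IsHeight.kerMatrix_congr {k k' : ExtChan E ω → E → S} {c : ExtChan E ω}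
    (hk : ∀ d, k d = k' d ∨ G.kerMatrix k c d = 0) : G.kerMatrix k c = G.kerMatrix k' c := by
  have h1 : G.kerMatrix k * (1 - G.encMatrix k) = 1 := Matrix.nonsing_inv_mul _ (hh.isUnit_det k)
  have h2 : (1 - G.encMatrix k') * G.kerMatrix k' = 1 := Matrix.mul_nonsing_inv _ (hh.isUnit_det k')
  have h3 : G.kerMatrix k - G.kerMatrix k' =
      G.kerMatrix k * (G.encMatrix k - G.encMatrix k') * G.kerMatrix k' := by
    calc _ = G.kerMatrix k * ((1 - G.encMatrix k') * G.kerMatrix k') -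
        (G.kerMatrix k * (1 - G.encMatrix k)) * G.kerMatrix k' := by rw [h1, h2, mul_one, one_mul]
      _ = _ := by noncomm_ring
  ext b
  rw [← sub_eq_zero, ← Matrix.sub_apply, h3, Matrix.mul_apply]
  refine Finset.sum_eq_zero fun a _ => ?_
  rw [Matrix.mul_apply, Finset.sum_eq_zero, zero_mul]
  intro d _
  rcases hk d with hd | hd
  · have : G.encMatrix k d a - G.encMatrix k' d a = 0 := by
      rcases a with i | e <;> simp [hd]
    rw [Matrix.sub_apply, this, mul_zero]
  · rw [hd, zero_mul]

theorem IsHeight.kerRow_congr {k k' : ExtChan E ω → E → S} {c : ExtChan E ω} (ξ : Finset E)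
    (hk : ∀ d, k d = k' d ∨ G.kerMatrix k c d = 0) : G.kerRow k ξ c = G.kerRow k' ξ c := by
  unfold kerRow
  rw [hh.kerMatrix_congr hk]

end Kernels

/-! ### Minors as polynomials in the coefficients -/

section MinorPolynomials

open scoped Classical

/-- Row rank equals column rank, so a basis chosen among the columns has as many members as there
are rows. -/
theorem _root_.LinearIndependent.exists_submatrix_isUnit {L m n : Type*} [Field L] [Fintype m]
    [DecidableEq m] [Fintype n] {N : Matrix m n L} (hN : LinearIndependent L N.row) :
    ∃ c : m → n, IsUnit (N.submatrix id c) := by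
  have hrank := hN.rank_matrix
  obtain ⟨κ, a, ha, hsp, hli⟩ := exists_linearIndependent' L N.col
  have : Finite κ := Finite.of_injective a ha
  have := Fintype.ofFinite κ
  have hcard : Fintype.card m = Fintype.card κ := by
    rw [← hrank, N.rank_eq_finrank_span_cols, ← hsp, finrank_span_eq_card hli]
  let σ := Fintype.equivOfCardEq hcard
  refine ⟨a ∘ σ, Matrix.linearIndependent_cols_iff_isUnit.1 ?_⟩
  exact hli.comp σ σ.injective

theorem _root_.MvPolynomial.degreeOf_det_le_one {σ F n : Type*} [CommRing F] [Fintype n]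
    [DecidableEq n]
    (Q : Matrix n n (MvPolynomial σ F)) (v : σ) (p : n × n)
    (hQ : ∀ a b, (Q a b).degreeOf v ≤ if (a, b) = p then 1 else 0) : Q.det.degreeOf v ≤ 1 := by
  rw [Matrix.det_apply]
  refine (MvPolynomial.degreeOf_sum_le _ _ _).trans (Finset.sup_le fun τ _ => ?_)
  have h1 : (Equiv.Perm.sign τ • ∏ i, Q (τ i) i).degreeOf v ≤ (∏ i, Q (τ i) i).degreeOf v := by
    rcases Int.units_eq_one_or (Equiv.Perm.sign τ) with hs | hs
    · simp [hs]
    · simp [hs, MvPolynomial.degreeOf_neg]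
  refine h1.trans ((MvPolynomial.degreeOf_prod_le _ _ _).trans ?_)
  calc ∑ i, (Q (τ i) i).degreeOf v ≤ ∑ i, if i = p.2 then 1 else 0 := by
        refine Finset.sum_le_sum fun i _ => (hQ _ _).trans ?_
        split_ifs with h1 h2 <;> simp_all [Prod.ext_iff]
    _ ≤ 1 := by simp

variable {V E : Type*} [Fintype E] (G : Network V E) {ω : ℕ}

/-- The minor of the matrix of global encoding kernels with rows `I` and columns `c`, as a
polynomial in the local encoding coefficients (up to a sign). -/
noncomputable def minorPoly (F : Type*) [Field F] (I : Finset (ExtChan E ω))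
    (c : {d // d ∈ I} → E) : MvPolynomial (ExtChan E ω × E) F :=
  (Matrix.fromBlocks (1 - G.encMatrix fun d e => MvPolynomial.X (d, e))
    (Matrix.of fun d i => if d = Sum.inr (c i) then 1 else 0)
    (Matrix.of fun i d => if d = i.1 then 1 else 0) 0).det

/-- Bordering $1-N$, instead of inverting it, keeps each coefficient in a single entry of the
matrix. -/
theorem degreeOf_minorPoly_le {F : Type*} [Field F] (I : Finset (ExtChan E ω))
    (c : {d // d ∈ I} → E) (v : ExtChan E ω × E) : (G.minorPoly F I c).degreeOf v ≤ 1 := by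
  unfold minorPoly
  refine MvPolynomial.degreeOf_det_le_one _ v (Sum.inl v.1, Sum.inl (Sum.inr v.2)) ?_
  have hone : ∀ (p : Prop) [Decidable p], MvPolynomial.degreeOf v
      (if p then (1 : MvPolynomial (ExtChan E ω × E) F) else 0) = 0 := by
    intro p _; split_ifs <;> simp
  rintro (d | i) (e | j)
  · rw [Matrix.fromBlocks_apply₁₁, Matrix.sub_apply]
    refine (MvPolynomial.degreeOf_sub_le _ _ _).trans (max_le ?_ ?_)
    · rw [Matrix.one_apply, hone]; exact Nat.zero_le _
    · rcases e with e | e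
      · simp
      · rw [encMatrix_inr]
        split_ifs with h1 h2 h2
        · rw [MvPolynomial.degreeOf_X]; split_ifs <;> simp
        · rw [MvPolynomial.degreeOf_X, if_neg]
          rintro rfl
          simp at h2
        · simp
        · simp
  · simp [hone]
  · simp [hone]
  · simp

variable {F L : Type*} [Field F] [Field L] [Algebra F L]

variable {G} in
-- By the Schur complement the bordered determinant is, up to sign, $\det(1-N)$ times the minor of
-- $(1-N)^{-1}$.
theorem IsHeight.aeval_minorPoly {h : ExtChan E ω → ℕ} (hh : G.IsHeight h)
    (k : ExtChan E ω → E → L) (I : Finset (ExtChan E ω)) (c : {d // d ∈ I} → E) :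
    MvPolynomial.aeval (fun v => k v.1 v.2) (G.minorPoly F I c) ≠ 0 ↔
      IsUnit ((G.kerMatrix k).submatrix (fun d : {d // d ∈ I} => d.1) fun i => Sum.inr (c i)) := by
  have hinv := Matrix.invertibleOfIsUnitDet _ (hh.isUnit_det k)
  have hmap : MvPolynomial.aeval (fun v => k v.1 v.2) (G.minorPoly F I c) =
      (Matrix.fromBlocks (1 - G.encMatrix k)
        (Matrix.of fun d i => if d = Sum.inr (c i) then 1 else 0)
        (Matrix.of fun (i : {d // d ∈ I}) d => if d = i.1 then 1 else 0) 0).det := by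
    rw [minorPoly, AlgHom.map_det]
    congr 1
    ext a b
    rw [AlgHom.mapMatrix_apply, Matrix.map_apply]
    rcases a with d | i <;> rcases b with e | j
    · rw [Matrix.fromBlocks_apply₁₁, Matrix.fromBlocks_apply₁₁, Matrix.sub_apply,
        Matrix.sub_apply, map_sub, Matrix.one_apply, Matrix.one_apply]
      congr 1
      · split_ifs <;> simp
      · rcases e with e | e
        · simp
        · rw [encMatrix_inr, encMatrix_inr]
          split_ifs <;> simp
    · simp only [Matrix.fromBlocks_apply₁₂, Matrix.of_apply]
      split_ifs <;> simp
    · simp only [Matrix.fromBlocks_apply₂₁, Matrix.of_apply]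
      split_ifs <;> simp
    · simp
  have hsub : (Matrix.of fun (i : {d // d ∈ I}) d => if d = i.1 then (1 : L) else 0) *
      ⅟(1 - G.encMatrix k) *
        (Matrix.of fun (d : ExtChan E ω) (i : {d // d ∈ I}) =>
          if d = Sum.inr (c i) then (1 : L) else 0) =
      (G.kerMatrix k).submatrix (fun d : {d // d ∈ I} => d.1) fun i => Sum.inr (c i) := by
    rw [Matrix.invOf_eq_nonsing_inv]
    ext i j
    simp [Matrix.mul_apply, kerMatrix]
  rw [hmap, Matrix.det_fromBlocks₁₁, zero_sub, hsub, Matrix.det_neg,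
    Matrix.isUnit_iff_isUnit_det, isUnit_iff_ne_zero, mul_ne_zero_iff, mul_ne_zero_iff]
  exact ⟨fun h => h.2.2, fun h => ⟨(hh.isUnit_det k).ne_zero, pow_ne_zero _ (by simp), h⟩⟩

variable {G} in
/-- Independent rows are detected by a minor. -/
theorem IsHeight.exists_aeval_minorPoly_ne_zero {h : ExtChan E ω → ℕ} (hh : G.IsHeight h)
    (F : Type*) [Field F] [Algebra F L]
    {k : ExtChan E ω → E → L} {ξ : Finset E} {I : Finset (ExtChan E ω)}
    (hI : LinearIndepOn L (G.kerRow k ξ) (I : Set (ExtChan E ω))) :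
    ∃ c : {d // d ∈ I} → {e // e ∈ ξ},
      MvPolynomial.aeval (fun v => k v.1 v.2) (G.minorPoly F I fun i => (c i).1) ≠ 0 := by
  have hI' : LinearIndependent L (Matrix.of fun (d : {d // d ∈ I}) => G.kerRow k ξ d.1).row := hI
  obtain ⟨c, hc⟩ := hI'.exists_submatrix_isUnit
  exact ⟨c, (hh.aeval_minorPoly k I _).2 hc⟩

variable {G} in
theorem IsHeight.linearIndepOn_of_aeval_minorPoly {h : ExtChan E ω → ℕ} (hh : G.IsHeight h)
    {k : ExtChan E ω → E → L} {ξ : Finset E} {I : Finset (ExtChan E ω)}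
    {c : {d // d ∈ I} → {e // e ∈ ξ}}
    (hc : MvPolynomial.aeval (fun v => k v.1 v.2) (G.minorPoly F I fun i => (c i).1) ≠ 0) :
    LinearIndepOn L (G.kerRow k ξ) (I : Set (ExtChan E ω)) := by
  have h1 := Matrix.linearIndependent_rows_iff_isUnit.2 ((hh.aeval_minorPoly k I _).1 hc)
  exact LinearIndependent.of_comp (LinearMap.funLeft L L c) h1

end MinorPolynomials

/-! ### Generic rank and separation -/

section GenericPoint

open scoped Classical
open Submodule (span)

variable {V E : Type*} [Fintype E] (F : Type*) [Field F] {G : Network V E} {ω : ℕ}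
  {h : ExtChan E ω → ℕ}

theorem IsHeight.kerMatrix_apply_self {S : Type*} [CommRing S] (hh : G.IsHeight h)
    (k : ExtChan E ω → E → S) (d : ExtChan E ω) : G.kerMatrix k d d = 1 := by
  rw [hh.kerMatrix_eq_enc_mul k, Matrix.add_apply, Matrix.one_apply_eq, Matrix.mul_apply,
    Finset.sum_eq_zero, zero_add]
  intro b _
  by_cases hb : G.encMatrix k d b = 0
  · rw [hb, zero_mul]
  · have hlt := hh.lt_of_encMatrix_ne_zero hb
    rw [hh.kerMatrix_apply_eq_zero k (fun hbd => by subst hbd; omega) hlt.le, mul_zero]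

/-- Algebraically independent local encoding coefficients. -/
noncomputable def genericCoeff (d : ExtChan E ω) (e : E) :
    FractionRing (MvPolynomial (ExtChan E ω × E) F) :=
  algebraMap (MvPolynomial (ExtChan E ω × E) F) _ (MvPolynomial.X (d, e))

variable {F} {L : Type*} [Field L] [Algebra F L]

/-- Rows that are independent for some local encoding coefficients are so generically. -/
theorem IsHeight.linearIndepOn_genericCoeff (hh : G.IsHeight h) {k : ExtChan E ω → E → L}
    {ξ : Finset E} {I : Finset (ExtChan E ω)}
    (hI : LinearIndepOn L (G.kerRow k ξ) (I : Set (ExtChan E ω))) :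
    LinearIndepOn (FractionRing (MvPolynomial (ExtChan E ω × E) F))
      (G.kerRow (genericCoeff F) ξ) (I : Set (ExtChan E ω)) := by
  obtain ⟨c, hc⟩ := hh.exists_aeval_minorPoly_ne_zero F hI
  refine hh.linearIndepOn_of_aeval_minorPoly (F := F) (c := c) ?_
  have h0 : G.minorPoly F I (fun i => (c i).1) ≠ 0 := fun h0 => hc (by rw [h0, map_zero])
  have h1 := MvPolynomial.aeval_algebraMap_apply (R := F)
    (FractionRing (MvPolynomial (ExtChan E ω × E) F))
    (MvPolynomial.X : ExtChan E ω × E → MvPolynomial (ExtChan E ω × E) F)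
    (G.minorPoly F I fun i => (c i).1)
  rw [MvPolynomial.aeval_X_left_apply] at h1
  have h2 : (fun v : ExtChan E ω × E => genericCoeff F v.1 v.2) =
    fun v => algebraMap (MvPolynomial (ExtChan E ω × E) F) _ (MvPolynomial.X v) := rfl
  rw [h2]
  refine ne_of_eq_of_ne h1 ?_
  rwa [Ne, FaithfulSMul.algebraMap_eq_zero_iff]

variable (F)

/-- Letting `d` forward only to `e` turns its row into that of `e` and leaves the rows of `S`, which
are not upstream of `d`, unchanged. Were the row of `e` independent of them, that of `d` would be
generically independent too. -/
theorem IsHeight.mem_span_of_genericCoeff (hh : G.IsHeight h) {ξ : Finset E}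
    {S : Set (ExtChan E ω)} {d : ExtChan E ω} (hd : d ∉ S) (hS : ∀ c ∈ S, h d ≤ h c)
    (hmem : G.kerRow (genericCoeff F) ξ d ∈ span (FractionRing (MvPolynomial (ExtChan E ω × E) F))
      (G.kerRow (genericCoeff F) ξ '' S)) :
    (∀ e ∈ ξ, d ≠ Sum.inr e) ∧ ∀ e, G.extHead d = G.tail e →
      G.kerRow (genericCoeff F) ξ (Sum.inr e) ∈
        span (FractionRing (MvPolynomial (ExtChan E ω × E) F))
          (G.kerRow (genericCoeff F) ξ '' S) := by
  have hne : ∀ c ∈ S, c ≠ d := fun c hc hcd => hd (hcd ▸ hc)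
  -- If `d` were in `ξ`, its own coordinate would be 1 in its row and 0 in all rows of `S`.
  have hdξ : ∀ e ∈ ξ, d ≠ Sum.inr e := by
    rintro e he rfl
    have hle : span (FractionRing (MvPolynomial (ExtChan E ω × E) F))
        (G.kerRow (genericCoeff F) ξ '' S) ≤ LinearMap.ker (LinearMap.proj ⟨e, he⟩) := by
      rw [Submodule.span_le]
      rintro _ ⟨c, hc, rfl⟩
      exact hh.kerMatrix_apply_eq_zero _ (hne c hc) (hS c hc)
    have h0 : G.kerMatrix (genericCoeff F) (Sum.inr e) (Sum.inr e) = 0 := hle hmem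
    rw [hh.kerMatrix_apply_self] at h0
    exact one_ne_zero h0
  refine ⟨hdξ, fun e hde => ?_⟩
  by_contra hnot
  obtain ⟨S₀, hS₀, -, hsp, hli⟩ := exists_linearIndepOn_extension
    (linearIndepOn_empty (FractionRing (MvPolynomial (ExtChan E ω × E) F))
      (G.kerRow (genericCoeff F) ξ)) (Set.empty_subset S)
  have hspan : span (FractionRing (MvPolynomial (ExtChan E ω × E) F))
      (G.kerRow (genericCoeff F) ξ '' S) ≤ span _ (G.kerRow (genericCoeff F) ξ '' S₀) :=
    Submodule.span_le.2 hsp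
  set k' := Function.update (genericCoeff F) d
    (Pi.single e (1 : FractionRing (MvPolynomial (ExtChan E ω × E) F))) with hk'
  have hrow : ∀ c, c ≠ d → h d ≤ h c → G.kerRow k' ξ c = G.kerRow (genericCoeff F) ξ c := by
    intro c hcd hle
    refine (hh.kerRow_congr ξ fun b => ?_).symm
    by_cases hb : b = d
    · exact Or.inr (by rw [hb]; exact hh.kerMatrix_apply_eq_zero _ hcd hle)
    · exact Or.inl (by rw [hk', Function.update_of_ne hb])
  have hlt := hh d e hde
  have hrowe := hrow (Sum.inr e) (fun hed => by rw [hed] at hlt; omega) hlt.le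
  have hrowd : G.kerRow k' ξ d = G.kerRow (genericCoeff F) ξ (Sum.inr e) := by
    rw [hh.kerRow_eq, Finset.sum_eq_single e, hrowe]
    · ext e'
      simp [hk', hdξ e'.1 e'.2]
    · intro b _ hb
      simp [hk', hb]
    · simp [hde]
  have hins : LinearIndepOn (FractionRing (MvPolynomial (ExtChan E ω × E) F))
      (G.kerRow k' ξ) (insert d S₀) := by
    have hcong : Set.EqOn (G.kerRow (genericCoeff F) ξ) (G.kerRow k' ξ) S₀ := fun c hc =>
      (hrow c (hne c (hS₀ hc)) (hS c (hS₀ hc))).symm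
    refine (hli.congr hcong).insert ?_
    rw [hrowd, ← hcong.image_eq]
    exact fun hm => hnot (Submodule.span_mono (Set.image_mono hS₀) hm)
  have hgen := hh.linearIndepOn_genericCoeff (F := F) (I := (Set.toFinite (insert d S₀)).toFinset)
    (by simpa using hins)
  rw [Set.Finite.coe_toFinset, linearIndepOn_insert fun hm => hd (hS₀ hm)] at hgen
  exact hgen.2 (hspan hmem)

/-- The generic rank of the rows `X` is at least the size of a set that separates `X` from `ξ`. -/
theorem IsHeight.exists_separation (hh : G.IsHeight h) (ξ : Finset E) (U : Finset (ExtChan E ω))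
    (hU : ∀ d ∈ U, ∀ e, G.extHead d = G.tail e → Sum.inr e ∈ U) (X : Finset (ExtChan E ω))
    (hX : X ⊆ U) : ∃ A B : Finset (ExtChan E ω), X ⊆ A ∪ B ∧
      A.card ≤ Module.finrank (FractionRing (MvPolynomial (ExtChan E ω × E) F))
        (span (FractionRing (MvPolynomial (ExtChan E ω × E) F))
          (G.kerRow (genericCoeff F) ξ '' (X : Set (ExtChan E ω)))) ∧
      ∀ d ∈ B, (∀ e ∈ ξ, d ≠ Sum.inr e) ∧ ∀ e, G.extHead d = G.tail e → Sum.inr e ∈ A ∪ B := by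
  induction U using Finset.strongInduction generalizing X with
  | H U ih =>
    rcases U.eq_empty_or_nonempty with rfl | hne
    · exact ⟨∅, ∅, by simpa using hX, by simp, by simp⟩
    obtain ⟨d, hdU, hmin⟩ := U.exists_min_image h hne
    have ih' := ih (U.erase d) (Finset.erase_ssubset hdU) fun b hb e hbe =>
      Finset.mem_erase.2 ⟨fun hed => by
        have h1 := hh b e hbe
        have h2 := hmin b (Finset.mem_of_mem_erase hb)
        rw [hed] at h1
        omega, hU b (Finset.mem_of_mem_erase hb) e hbe⟩
    by_cases hdX : d ∈ X
    swap
    · exact ih' X fun c hc => Finset.mem_erase.2 ⟨fun hcd => hdX (hcd ▸ hc), hX hc⟩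
    by_cases hmem : G.kerRow (genericCoeff F) ξ d ∈
        span (FractionRing (MvPolynomial (ExtChan E ω × E) F))
          (G.kerRow (genericCoeff F) ξ '' (X.erase d : Finset (ExtChan E ω)))
    -- Dependent case: trading `d` for its successors does not enlarge the span, and `d` goes into
    -- `B`.
    · obtain ⟨hdξ, hout⟩ := hh.mem_span_of_genericCoeff F (by simp)
        (fun c hc => hmin c (hX (Finset.mem_of_mem_erase hc))) hmem
      obtain ⟨A, B, hAB, hcard, hB⟩ := ih'
        (X.erase d ∪ (Finset.univ.filter fun e => G.extHead d = G.tail e).map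
          Function.Embedding.inr) (by
        intro c hc
        simp only [Finset.mem_union, Finset.mem_erase, Finset.mem_map, Finset.mem_filter,
          Finset.mem_univ, true_and, Function.Embedding.inr_apply] at hc ⊢
        rcases hc with ⟨hcd, hc⟩ | ⟨e, hde, rfl⟩
        · exact ⟨hcd, hX hc⟩
        · have := hh d e hde
          exact ⟨fun hed => by rw [hed] at this; omega, hU d hdU e hde⟩)
      refine ⟨A, insert d B, ?_, hcard.trans (Submodule.finrank_mono (Submodule.span_le.2 ?_)), ?_⟩
      · intro c hc
        by_cases hcd : c = d
        · simp [hcd]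
        · have := hAB (Finset.mem_union_left _ (Finset.mem_erase.2 ⟨hcd, hc⟩))
          rw [Finset.union_insert]
          exact Finset.mem_insert_of_mem this
      · rintro _ ⟨c, hc, rfl⟩
        have hsub : span (FractionRing (MvPolynomial (ExtChan E ω × E) F))
            (G.kerRow (genericCoeff F) ξ '' (X.erase d : Finset (ExtChan E ω))) ≤
            span _ (G.kerRow (genericCoeff F) ξ '' (X : Set (ExtChan E ω))) :=
          Submodule.span_mono (Set.image_mono (Finset.coe_subset.2 (Finset.erase_subset d X)))
        rcases Finset.mem_union.1 (Finset.mem_coe.1 hc) with hc | hc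
        · exact Submodule.subset_span ⟨c, Finset.mem_of_mem_erase hc, rfl⟩
        · simp only [Finset.mem_map, Finset.mem_filter, Finset.mem_univ, true_and,
            Function.Embedding.inr_apply] at hc
          obtain ⟨e, hde, rfl⟩ := hc
          exact hsub (hout e hde)
      · intro b hb
        rw [Finset.union_insert]
        rcases Finset.mem_insert.1 hb with rfl | hb
        · refine ⟨hdξ, fun e hde => Finset.mem_insert_of_mem (hAB (Finset.mem_union_right _ ?_))⟩
          simpa using hde
        · exact ⟨(hB b hb).1, fun e hbe => Finset.mem_insert_of_mem ((hB b hb).2 e hbe)⟩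
    -- Independent case: erasing `d` lowers the rank, which pays for putting `d` into `A`.
    · obtain ⟨A, B, hAB, hcard, hB⟩ := ih' (X.erase d) (Finset.erase_subset_erase d hX)
      refine ⟨insert d A, B, ?_, ?_, fun b hb => ⟨(hB b hb).1, fun e hbe => ?_⟩⟩
      · rw [Finset.insert_union, ← Finset.insert_erase hdX]
        exact Finset.insert_subset_insert d hAB
      · refine (Finset.card_insert_le _ _).trans ((Nat.succ_le_succ hcard).trans ?_)
        refine Nat.succ_le_of_lt (Submodule.finrank_lt_finrank_of_lt ?_)
        refine SetLike.lt_iff_le_and_exists.2 ⟨Submodule.span_mono (Set.image_mono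
          (Finset.coe_subset.2 (Finset.erase_subset d X))), _,
          Submodule.subset_span ⟨d, hdX, rfl⟩, hmem⟩
      · rw [Finset.insert_union]
        exact Finset.mem_insert_of_mem ((hB b hb).2 e hbe)

end GenericPoint

/-! ### Cuts of channels and the field bound -/

section Cuts

open scoped Classical

variable {V E : Type*} (G : Network V E)

/-- The set `A` of channels separates the source from the channels in `ξ`: there is a set of nodes
containing the source which can be left only through `A` and from which no channel in `ξ` outside
`A` starts. -/
def IsChanCut (ξ A : Finset E) : Prop :=
  ∃ W : Set V, G.source ∈ W ∧ ∀ e ∉ A, G.tail e ∈ W → e ∉ ξ ∧ G.head e ∈ W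

/-- The least number of channels that separate the source from the channels in `ξ`. -/
noncomputable def chanCutNum (ξ : Finset E) : ℕ :=
  sInf {n | ∃ A : Finset E, G.IsChanCut ξ A ∧ A.card = n}

theorem isChanCut_self (ξ : Finset E) : G.IsChanCut ξ ξ :=
  ⟨Set.univ, trivial, fun _ he _ => ⟨he, trivial⟩⟩

theorem exists_isChanCut_card_eq (ξ : Finset E) :
    ∃ A : Finset E, G.IsChanCut ξ A ∧ A.card = G.chanCutNum ξ :=
  Nat.sInf_mem (s := {n | ∃ A : Finset E, G.IsChanCut ξ A ∧ A.card = n})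
    ⟨_, ξ, G.isChanCut_self ξ, rfl⟩

variable {G} in
theorem IsChanCut.chanCutNum_le {ξ A : Finset E} (hA : G.IsChanCut ξ A) :
    G.chanCutNum ξ ≤ A.card :=
  Nat.sInf_le ⟨A, hA, rfl⟩

theorem chanCutNum_le_card (ξ : Finset E) : G.chanCutNum ξ ≤ ξ.card :=
  (G.isChanCut_self ξ).chanCutNum_le

variable {G} {ξ η : Finset E} {T : Finset (V ⊕ {e // e ∈ η})}

theorem IsChanCut.exists_isCut (hT : ∀ e : {e // e ∈ η}, Sum.inr e ∈ T → e.1 ∈ ξ)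
    (hT' : ∀ v, Sum.inl v ∉ T) {A : Finset E} (hA : G.IsChanCut ξ A) :
    ∃ A', (G.subdivide η).IsCut T A' ∧ A'.card ≤ A.card := by
  obtain ⟨W, hs, hW⟩ := hA
  -- A subdivided channel is cut in its first half, the only way into its new node.
  refine ⟨A.image fun e => if he : e ∈ η then Sum.inr (Sum.inl ⟨e, he⟩) else Sum.inl ⟨e, he⟩,
    fun t ht hreach => ?_, Finset.card_image_le⟩
  have key : Sum.elim (fun v => v ∈ W) (fun e => G.tail e.1 ∈ W ∧ e.1 ∉ A) t := by
    clear ht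
    induction hreach with
    | refl => exact hs
    | tail _ hstep ih =>
      obtain ⟨e, he, rfl, rfl⟩ := hstep
      rcases e with e | e | e
      · have heA : e.1 ∉ A := fun heA => he (Finset.mem_image.2 ⟨e.1, heA, by simp [e.2]⟩)
        exact (hW e.1 heA ih).2
      · have heA : e.1 ∉ A := fun heA => he (Finset.mem_image.2 ⟨e.1, heA, by simp [e.2]⟩)
        exact ⟨ih, heA⟩
      · exact (hW e.1 ih.2 ih.1).2
  rcases t with v | e
  · exact hT' v ht
  · exact (hW e.1 key.2 key.1).1 (hT e ht)

theorem IsCut.exists_isChanCut (hξη : ξ ⊆ η) (hT : ∀ e : {e // e ∈ η}, e.1 ∈ ξ → Sum.inr e ∈ T)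
    {A' : Finset ({e // e ∉ η} ⊕ ({e // e ∈ η} ⊕ {e // e ∈ η}))}
    (hA' : (G.subdivide η).IsCut T A') : ∃ A, G.IsChanCut ξ A ∧ A.card ≤ A'.card := by
  -- Cutting either half of a channel counts as cutting the channel; the old nodes still reachable
  -- serve as `W`.
  refine ⟨A'.image (Sum.elim Subtype.val (Sum.elim Subtype.val Subtype.val)),
    ⟨{v | Relation.ReflTransGen ((G.subdivide η).Step A') (G.subdivide η).source (Sum.inl v)},
      Relation.ReflTransGen.refl, fun e heA hte => ?_⟩, Finset.card_image_le⟩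
  have hmem : ∀ x ∈ A', Sum.elim Subtype.val (Sum.elim Subtype.val Subtype.val) x ≠ e :=
    fun x hx hxe => heA (Finset.mem_image.2 ⟨x, hx, hxe⟩)
  by_cases heη : e ∈ η
  · have h1 : Relation.ReflTransGen ((G.subdivide η).Step A') (G.subdivide η).source
        (Sum.inr ⟨e, heη⟩) :=
      hte.tail ⟨Sum.inr (Sum.inl ⟨e, heη⟩), fun hx => hmem _ hx rfl, rfl, rfl⟩
    exact ⟨fun heξ => hA' _ (hT ⟨e, heη⟩ heξ) h1,
      h1.tail ⟨Sum.inr (Sum.inr ⟨e, heη⟩), fun hx => hmem _ hx rfl, rfl, rfl⟩⟩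
  · exact ⟨fun heξ => heη (hξη heξ), hte.tail ⟨Sum.inl ⟨e, heη⟩, fun hx => hmem _ hx rfl, rfl, rfl⟩⟩

/-- The minimum cut capacity of `{n_e : e ∈ ξ}` does not depend on which further channels are
subdivided. -/
theorem minCut_subdivide (hξη : ξ ⊆ η) (hT : ∀ e : {e // e ∈ η}, Sum.inr e ∈ T ↔ e.1 ∈ ξ)
    (hT' : ∀ v, Sum.inl v ∉ T) : (G.subdivide η).minCut T = G.chanCutNum ξ := by
  obtain ⟨A, hA, hcard⟩ := G.exists_isChanCut_card_eq ξ
  obtain ⟨A', hA', hcard'⟩ := hA.exists_isCut (fun e => (hT e).1) hT'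
  apply le_antisymm
  · rw [← hcard]
    exact le_trans (Nat.sInf_le ⟨A', hA', rfl⟩) hcard'
  · obtain ⟨B', hB', hB⟩ := Nat.sInf_mem (s := {n | ∃ A, (G.subdivide η).IsCut T A ∧ A.card = n})
      ⟨_, A', hA', rfl⟩
    obtain ⟨B, hBc, hle⟩ := hB'.exists_isChanCut hξη fun e => (hT e).2
    exact hBc.chanCutNum_le.trans (hle.trans hB.le)

theorem chanMinCut_eq_chanCutNum (ξ : Finset E) : G.chanMinCut ξ = G.chanCutNum ξ :=
  minCut_subdivide subset_rfl (fun e => by simp) (by simp)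

/-- The left side counts the pairs `(ξ, ρ)` that have to be handled. Sending `ξ` to its set of new
nodes is injective and preserves the capacity. -/
theorem sum_choose_le_fieldBound [Fintype V] [Fintype E] (G : Network V E) (ω : ℕ) :
    ∑ ξ : Finset E with ξ.Nonempty, (Fintype.card E).choose (G.chanCutNum ξ - ω) ≤
      G.fieldBound ω := by
  let τ : Finset E → Finset (V ⊕ {e // e ∈ (Finset.univ : Finset E)}) := fun ξ =>
    (ξ.map ⟨fun e => ⟨e, Finset.mem_univ e⟩, fun a b hab => congrArg Subtype.val hab⟩).map
      Function.Embedding.inr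
  have hτ : ∀ ξ (e : {e // e ∈ (Finset.univ : Finset E)}), Sum.inr e ∈ τ ξ ↔ e.1 ∈ ξ := by
    intro ξ e
    simp only [τ, Finset.mem_map, Function.Embedding.inr_apply]
    constructor
    · rintro ⟨_, ⟨a, ha, rfl⟩, hae⟩
      rwa [← Sum.inr.inj hae]
    · exact fun he => ⟨e, ⟨e.1, he, rfl⟩, rfl⟩
  have hτ' : ∀ ξ v, Sum.inl v ∉ τ ξ := by simp [τ]
  have hcut : ∀ ξ, (G.subdivide Finset.univ).minCut (τ ξ) = G.chanCutNum ξ := fun ξ =>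
    minCut_subdivide (Finset.subset_univ ξ) (hτ ξ) (hτ' ξ)
  have hinj : Function.Injective τ := fun ξ ξ' heq => by
    ext e
    rw [← hτ ξ ⟨e, Finset.mem_univ e⟩, heq, hτ]
  have hcoll : ∀ ξ : Finset E, ξ.Nonempty → τ ξ ∈ (G.subdivide Finset.univ).collections := by
    intro ξ hξ
    simp only [collections, Finset.mem_filter, Finset.mem_univ, true_and]
    exact ⟨by simpa [τ] using hξ, hτ' ξ _⟩
  set g : Finset (V ⊕ {e // e ∈ (Finset.univ : Finset E)}) → ℕ := fun T =>
    (2 * Fintype.card E + ∑ S ∈ (G.subdivide Finset.univ).collections,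
      ∑ t ∈ S, (G.subdivide Finset.univ).minCut {t}).choose
        ((G.subdivide Finset.univ).minCut T - ω) with hg
  -- For $C_T<\omega$ the truncated difference is 0 and the binomial coefficient is 1, so both parts
  -- of the bound form one sum.
  have hbound : G.fieldBound ω = ∑ T ∈ (G.subdivide Finset.univ).collections, g T := by
    rw [← Finset.sum_filter_add_sum_filter_not _ fun T => ω ≤ (G.subdivide Finset.univ).minCut T,
      fieldBound]
    congr 1
    rw [Finset.card_eq_sum_ones]
    simp only [not_le]
    refine Finset.sum_congr rfl fun T hT => ?_
    rw [hg]
    dsimp only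
    rw [Nat.sub_eq_zero_of_le (Finset.mem_filter.1 hT).2.le, Nat.choose_zero_right]
  rw [hbound]
  calc _ ≤ ∑ ξ : Finset E with ξ.Nonempty, g (τ ξ) := by
        refine Finset.sum_le_sum fun ξ _ => ?_
        rw [hg]
        dsimp only
        rw [hcut]
        exact Nat.choose_le_choose _ (by omega)
    _ = ∑ T ∈ (Finset.univ.filter fun ξ : Finset E => ξ.Nonempty).map ⟨τ, hinj⟩, g T := by
        rw [Finset.sum_map]
        rfl
    _ ≤ _ := by
        refine Finset.sum_le_sum_of_subset fun T hT => ?_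
        obtain ⟨ξ, hξ, rfl⟩ := Finset.mem_map.1 hT
        exact hcoll ξ (by simpa using hξ)

end Cuts

/-! ### Separating messages from errors, and the Singleton bound -/

section Codes

open scoped Classical
open Submodule (span)

variable {V E : Type*} [Fintype E] {G : Network V E} {ω : ℕ} {h : ExtChan E ω → ℕ}

theorem IsHeight.kerMatrix_inl {S : Type*} [CommRing S] (hh : G.IsHeight h)
    (k : ExtChan E ω → E → S) (d : ExtChan E ω) (i : Fin ω) :
    G.kerMatrix k d (Sum.inl i) = if d = Sum.inl i then 1 else 0 := by
  rw [hh.kerMatrix_eq_mul_enc k, Matrix.add_apply, Matrix.mul_apply, Matrix.one_apply]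
  simp

/-- The code with given local encoding coefficients. -/
noncomputable def IsHeight.code {F : Type*} [Field F] (hh : G.IsHeight h)
    (k : ExtChan E ω → E → F) : LNECCode G F ω where
  k := k
  f e d := G.kerMatrix k d (Sum.inr e)
  f_eq e := by
    have hext : ∀ b d, extKernel (fun e d => G.kerMatrix k d (Sum.inr e)) b d =
        G.kerMatrix k d b := by
      rintro (i | b) d
      · simp [extKernel, unitKernel, hh.kerMatrix_inl, Pi.single_apply]
      · rfl
    ext d
    refine (congrFun (congrFun (hh.kerMatrix_eq_mul_enc k) d) (Sum.inr e)).trans ?_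
    rw [Matrix.add_apply, Matrix.mul_apply, Matrix.one_apply, Pi.add_apply, Finset.sum_apply]
    congr 1
    · simp only [encMatrix_inr, mul_ite, mul_zero, Pi.smul_apply, hext, smul_eq_mul, Network.In,
        Finset.sum_filter]
      exact Finset.sum_congr rfl fun b _ => by split_ifs <;> ring
    · simp [unitKernel, Set.indicator_apply]

/-- Inside `W` the recursion for rows has no unit vector term and can be unfolded until it meets
`A`. The induction descends from the greatest height. -/
theorem IsHeight.kerRow_mem_span_of_isChanCut {L : Type*} [Field L] (hh : G.IsHeight h)
    (k : ExtChan E ω → E → L) {ξ A : Finset E} {W : Set V}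
    (hW : ∀ e ∉ A, G.tail e ∈ W → e ∉ ξ ∧ G.head e ∈ W) (d : ExtChan E ω)
    (hd : G.extHead d ∈ W) (hdξ : ∀ e ∈ ξ, d ≠ Sum.inr e) :
    G.kerRow k ξ d ∈ span L ((fun e => G.kerRow k ξ (Sum.inr e)) '' (A : Set E)) := by
  induction hn : Finset.univ.sup h - h d using Nat.strong_induction_on generalizing d with
  | _ n ih =>
    have hzero : (fun e : {e // e ∈ ξ} => if d = Sum.inr e.1 then (1 : L) else 0) = 0 := by
      ext e
      simp [hdξ e.1 e.2]
    rw [hh.kerRow_eq, hzero, add_zero]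
    refine Submodule.sum_mem _ fun e he => Submodule.smul_mem _ _ ?_
    have hde := (Finset.mem_filter.1 he).2
    by_cases heA : e ∈ A
    · exact Submodule.subset_span ⟨e, heA, rfl⟩
    · obtain ⟨h1, h2⟩ := hW e heA (hde ▸ hd)
      have h3 := hh d e hde
      have h4 : h (Sum.inr e) ≤ Finset.univ.sup h := Finset.le_sup (Finset.mem_univ _)
      exact ih _ (by omega) _ h2 (fun e' he' hee => h1 (by rwa [Sum.inr.inj hee])) rfl

/-- The generic rank of the rows of the channels that leave the source is at least `C_ξ`. -/
theorem IsHeight.chanCutNum_le_finrank (F : Type*) [Field F] (hh : G.IsHeight h) (ξ : Finset E) :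
    G.chanCutNum ξ ≤ Module.finrank (FractionRing (MvPolynomial (ExtChan E ω × E) F))
      (span (FractionRing (MvPolynomial (ExtChan E ω × E) F))
        (G.kerRow (genericCoeff (ω := ω) F) ξ '' (Sum.inr '' {e | G.tail e = G.source}))) := by
  obtain ⟨A, B, hAB, hcard, hB⟩ := hh.exists_separation F ξ (Finset.univ.map .inr)
    (by simp) ((Finset.univ.filter fun e => G.tail e = G.source).map .inr)
    (Finset.map_subset_map.2 (Finset.subset_univ _))
  have hX : (((Finset.univ.filter fun e => G.tail e = G.source).map Function.Embedding.inr :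
      Finset (ExtChan E ω)) : Set (ExtChan E ω)) = Sum.inr '' {e | G.tail e = G.source} := by
    simp
  rw [hX] at hcard
  -- The source side of the cut consists of the nodes all of whose outgoing channels lie in `A ∪ B`.
  refine le_trans (IsChanCut.chanCutNum_le (A := Finset.univ.filter fun e => Sum.inr e ∈ A)
    ⟨{v | ∀ e, G.tail e = v → Sum.inr e ∈ A ∪ B}, ?_, ?_⟩) (le_trans ?_ hcard)
  · intro e he
    exact hAB (by simpa using he)
  · intro e heA hte
    have heB : Sum.inr e ∈ B := by
      simp only [Finset.mem_filter, Finset.mem_univ, true_and] at heA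
      exact (Finset.mem_union.1 (hte e rfl)).resolve_left heA
    exact ⟨fun heξ => (hB _ heB).1 e heξ rfl, fun e' he' => (hB _ heB).2 e' he'.symm⟩
  · exact Finset.card_le_card_of_injOn Sum.inr (fun e he => by simpa using he)
      Sum.inr_injective.injOn

/-- If `ω` or fewer messages and an error pattern `ρ` fit into the capacity of `ξ`, then a single
polynomial, linear in each local encoding coefficient, makes sure that the messages can be
separated from the errors. -/
theorem IsHeight.exists_separating_polynomial (F : Type*) [Field F] (hh : G.IsHeight h)
    {ξ ρ : Finset E} {J : Finset (Fin ω)} (hJ : J.card + ρ.card ≤ G.chanCutNum ξ) :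
    ∃ P : MvPolynomial (ExtChan E ω × E) F, P ≠ 0 ∧ (∀ v, P.degreeOf v ≤ 1) ∧
      ∀ k : ExtChan E ω → E → F, MvPolynomial.eval (fun v => k v.1 v.2) P ≠ 0 →
        LinearIndepOn F (G.kerRow k ξ) (Sum.inl '' (J : Set (Fin ω))) ∧
        Disjoint (span F (G.kerRow k ξ '' (Sum.inl '' (J : Set (Fin ω)))))
          (span F (G.kerRow k ξ '' (Sum.inr '' (ρ : Set E)))) := by
  set L := FractionRing (MvPolynomial (ExtChan E ω × E) F) with hL
  set v := G.kerRow (genericCoeff (ω := ω) F) ξ with hv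
  obtain ⟨ρ₀, hρ₀, -, hspan₀, hli₀⟩ := exists_linearIndepOn_extension
    (linearIndepOn_empty L v) (Set.empty_subset (Sum.inr '' (ρ : Set E)))
  obtain ⟨b, hb, hρ₀b, hspanb, hlib⟩ := exists_linearIndepOn_extension hli₀
    (Set.subset_union_left (t := Sum.inr '' {e | G.tail e = G.source}))
  have hcard₀ : ρ₀.ncard ≤ ρ.card := by
    refine (Set.ncard_le_ncard hρ₀ (Set.toFinite _)).trans ?_
    rw [Set.ncard_image_of_injective _ Sum.inr_injective, Set.ncard_coe_finset]
  have hcardb : G.chanCutNum ξ ≤ b.ncard := by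
    refine (hh.chanCutNum_le_finrank F ξ).trans ?_
    have h1 : Module.finrank L (span L (v '' b)) = b.ncard := by
      have h2 := finrank_span_eq_card (R := L) (b := fun x : b => v x) hlib
      rw [Set.image_eq_range, h2, ← Nat.card_coe_set_eq, Nat.card_eq_fintype_card]
    rw [← h1]
    refine Submodule.finrank_mono (Submodule.span_le.2 ?_)
    exact (Set.image_mono Set.subset_union_right).trans hspanb
  -- At least $C_\xi-|\rho|\ge|J|$ channels of `b` lie outside `ρ₀`; all of them leave the source.
  have hemb : Nonempty (J ↪ (b \ ρ₀ : Set (ExtChan E ω))) := by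
    refine Function.Embedding.nonempty_of_card_le ?_
    rw [← Nat.card_eq_fintype_card (α := (b \ ρ₀ : Set (ExtChan E ω))), Nat.card_coe_set_eq,
      Set.ncard_sdiff hρ₀b, Fintype.card_coe]
    omega
  obtain ⟨ε⟩ := hemb
  have hε : ∀ i, ∃ e, Sum.inr e = (ε i).1 ∧ G.tail e = G.source := by
    intro i
    obtain ⟨e, he, hei⟩ := (hb (ε i).2.1).resolve_left (ε i).2.2
    exact ⟨e, hei, he⟩
  choose a ha has using hε
  -- Each message in `J` is sent along its own channel of `b \ ρ₀` and so takes over the row of that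
  -- channel.
  let k' : ExtChan E ω → E → L := Sum.elim
    (fun i => if hi : i ∈ J then Pi.single (a ⟨i, hi⟩) 1 else 0)
    (fun d => genericCoeff F (Sum.inr d))
  have hinr : ∀ e, G.kerRow k' ξ (Sum.inr e) = v (Sum.inr e) := by
    intro e
    refine (hh.kerRow_congr ξ fun d => ?_).symm
    rcases d with i | d
    · right
      rw [hh.kerMatrix_inl, if_neg Sum.inr_ne_inl]
    · exact Or.inl rfl
  have hinl : ∀ i (hi : i ∈ J), G.kerRow k' ξ (Sum.inl i) = v (ε ⟨i, hi⟩) := by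
    intro i hi
    rw [hh.kerRow_eq, Finset.sum_eq_single (a ⟨i, hi⟩)]
    · rw [hinr, ha]
      ext e
      simp [k', hi]
    · intro e _ he
      simp [k', hi, he]
    · intro hn
      simp only [Finset.mem_filter, Finset.mem_univ, true_and] at hn
      exact absurd (has ⟨i, hi⟩).symm hn
  let φ : ExtChan E ω → ExtChan E ω :=
    Sum.elim (fun i => if hi : i ∈ J then (ε ⟨i, hi⟩).1 else Sum.inl i) Sum.inr
  let I : Finset (ExtChan E ω) := J.map .inl ∪ ρ₀.toFinset
  have hI : (I : Set (ExtChan E ω)) = Sum.inl '' (J : Set (Fin ω)) ∪ ρ₀ := by simp [I]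
  have hρ₀inr : ∀ x ∈ ρ₀, ∃ e, x = Sum.inr e := fun x hx => by
    obtain ⟨e, -, he⟩ := hρ₀ hx
    exact ⟨e, he.symm⟩
  have hliI : LinearIndepOn L (G.kerRow k' ξ) (I : Set (ExtChan E ω)) := by
    rw [hI]
    have hφb : φ '' (Sum.inl '' (J : Set (Fin ω)) ∪ ρ₀) ⊆ b := by
      rintro _ ⟨_, ⟨i, hi, rfl⟩ | hx, rfl⟩
      · simp only [φ, Sum.elim_inl, dif_pos (Finset.mem_coe.1 hi)]
        exact (ε _).2.1
      · obtain ⟨e, rfl⟩ := hρ₀inr _ hx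
        exact hρ₀b hx
    have hφinj : Set.InjOn φ (Sum.inl '' (J : Set (Fin ω)) ∪ ρ₀) := by
      rintro _ (⟨i, hi, rfl⟩ | hx) _ (⟨j, hj, rfl⟩ | hy) hxy
      · simp only [φ, Sum.elim_inl, dif_pos (Finset.mem_coe.1 hi),
          dif_pos (Finset.mem_coe.1 hj)] at hxy
        rw [Subtype.mk.inj (ε.injective (Subtype.ext hxy))]
      · obtain ⟨e, rfl⟩ := hρ₀inr _ hy
        simp only [φ, Sum.elim_inl, dif_pos (Finset.mem_coe.1 hi), Sum.elim_inr] at hxy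
        exact absurd (hxy ▸ hy) (ε _).2.2
      · obtain ⟨e, rfl⟩ := hρ₀inr _ hx
        simp only [φ, Sum.elim_inl, dif_pos (Finset.mem_coe.1 hj), Sum.elim_inr] at hxy
        exact absurd (hxy ▸ hx) (ε _).2.2
      · obtain ⟨e, rfl⟩ := hρ₀inr _ hx
        obtain ⟨e', rfl⟩ := hρ₀inr _ hy
        exact hxy
    refine ((hlib.mono hφb).comp_of_image hφinj).congr ?_
    rintro _ (⟨i, hi, rfl⟩ | hx)
    · rw [hinl i hi]
      simp only [Function.comp_apply, φ, Sum.elim_inl, dif_pos (Finset.mem_coe.1 hi)]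
    · obtain ⟨e, rfl⟩ := hρ₀inr _ hx
      exact (hinr e).symm
  obtain ⟨c, hc⟩ := hh.exists_aeval_minorPoly_ne_zero F hliI
  refine ⟨_, fun h0 => hc (by rw [h0, map_zero]), G.degreeOf_minorPoly_le I _, fun k hk => ?_⟩
  have hlik : LinearIndepOn F (G.kerRow k ξ) (I : Set (ExtChan E ω)) :=
    hh.linearIndepOn_of_aeval_minorPoly (F := F) (by rwa [MvPolynomial.aeval_eq_eval])
  rw [hI] at hlik
  refine ⟨hlik.mono Set.subset_union_left, ?_⟩
  -- Specialization cannot raise the rank of `ρ`: a basis containing `ρ₀` at `k` is generically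
  -- independent, and generically `ρ₀` already spans. So the same minor controls all of `ρ`.
  obtain ⟨ρ₁, hρ₁, hρ₀₁, hspan₁, hli₁⟩ := exists_linearIndepOn_extension
    (hlik.mono Set.subset_union_right) hρ₀
  have hρ₁₀ : ρ₁ ⊆ ρ₀ := by
    intro x hx
    by_contra hx₀
    have hgen := hh.linearIndepOn_genericCoeff (F := F) (I := ρ₁.toFinset) (by simpa using hli₁)
    rw [Set.coe_toFinset] at hgen
    have hins := hgen.mono (Set.insert_subset hx hρ₀₁)
    rw [linearIndepOn_insert hx₀] at hins
    exact hins.2 (hspan₀ ⟨x, hρ₁ hx, rfl⟩)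
  have hspan : span F (G.kerRow k ξ '' (Sum.inr '' (ρ : Set E))) ≤ span F (G.kerRow k ξ '' ρ₀) :=
    Submodule.span_le.2 (hspan₁.trans (Submodule.span_mono (Set.image_mono hρ₁₀)))
  refine Disjoint.mono_right hspan ?_
  refine ((linearIndepOn_union_iff ?_).1 hlik).2.2
  rw [Set.disjoint_left]
  rintro _ ⟨i, -, rfl⟩ hx
  obtain ⟨e, he⟩ := hρ₀inr _ hx
  exact Sum.inl_ne_inr he

/-- The Singleton bound. -/
theorem exists_errSpace_inf_msgSpace_ne_bot {F : Type*} [Field F] (K : LNECCode G F ω)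
    {ξ A : Finset E} (hle : K.msgSpace ξ ≤ K.errSpace ξ A) {n : ℕ}
    (hn : n < Module.finrank F (K.msgSpace ξ)) (hnA : n ≤ A.card) :
    ∃ ρ : Finset E, ρ.card = A.card - n ∧ K.errSpace ξ ρ ⊓ K.msgSpace ξ ≠ ⊥ := by
  -- Dropping `n` channels of `A` costs at most `n` dimensions, fewer than the message space has.
  obtain ⟨B, hBA, hB⟩ := Finset.exists_subset_card_eq hnA
  refine ⟨A \ B, by rw [Finset.card_sdiff_of_subset hBA, hB], fun hbot => ?_⟩
  have hsup : K.errSpace ξ (A \ B) ⊔ K.msgSpace ξ ≤ K.errSpace ξ (A \ B) ⊔ K.errSpace ξ B := by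
    refine sup_le le_sup_left (hle.trans ?_)
    unfold LNECCode.errSpace
    rw [← Submodule.span_union, ← Set.image_union, ← Finset.coe_union,
      Finset.sdiff_union_of_subset hBA]
  have h1 := Submodule.finrank_sup_add_finrank_inf_eq (K.errSpace ξ (A \ B)) (K.msgSpace ξ)
  have h2 := Submodule.finrank_mono hsup
  have h3 := Submodule.finrank_add_le_finrank_add_finrank (K.errSpace ξ (A \ B)) (K.errSpace ξ B)
  have h4 : Module.finrank F (K.errSpace ξ B) ≤ B.card := by
    have h := finrank_span_finset_le_card (R := F) (B.image fun e => K.row ξ (Sum.inr e))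
    rw [Set.finrank, Finset.coe_image] at h
    exact h.trans Finset.card_image_le
  rw [hbot, finrank_bot] at h1
  omega

end Codes

end Network

/-! ### Choosing the coefficients and computing the distances -/

section Existence

open scoped Classical
open Submodule (span)

/-- A product of few polynomials that are linear in each variable has a nonzero value. -/
theorem MvPolynomial.exists_forall_eval_ne_zero {σ ι F : Type*} [Finite σ] [Field F]
    (s : Finset ι) (P : ι → MvPolynomial σ F) (hP : ∀ i ∈ s, P i ≠ 0)
    (hdeg : ∀ i ∈ s, ∀ v, (P i).degreeOf v ≤ 1) (hF : (s.card : ℕ∞) < ENat.card F) :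
    ∃ x : σ → F, ∀ i ∈ s, MvPolynomial.eval x (P i) ≠ 0 := by
  have hS : ∃ S : Finset F, s.card < S.card := by
    rcases finite_or_infinite F with hfin | hinf
    · have := Fintype.ofFinite F
      exact ⟨Finset.univ, by simpa [ENat.card_eq_coe_fintype_card] using hF⟩
    · obtain ⟨S, hS⟩ := Infinite.exists_subset_card_eq F (s.card + 1)
      exact ⟨S, by omega⟩
  obtain ⟨S, hS⟩ := hS
  by_contra! hcon
  refine Finset.prod_ne_zero_iff.2 hP (MvPolynomial.eq_zero_of_eval_zero_at_prod_finset
    (∏ i ∈ s, P i) (fun _ => S) (fun v => ?_) fun x _ => ?_)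
  · calc _ ≤ ∑ i ∈ s, (P i).degreeOf v := MvPolynomial.degreeOf_prod_le _ _ _
      _ ≤ ∑ i ∈ s, 1 := Finset.sum_le_sum fun i hi => hdeg i hi v
      _ < S.card := by simpa using hS
  · obtain ⟨i, hi, hx⟩ := hcon x
    rw [map_prod]
    exact Finset.prod_eq_zero hi hx

variable {V E F : Type*} [Fintype V] [Fintype E] [Field F] {G : Network V E} {ω : ℕ}
  {h : ExtChan E ω → ℕ}

/-- Over a large field, some local encoding coefficients separate messages and errors at all sets
of channels. -/
theorem Network.IsHeight.exists_coeff (hh : G.IsHeight h)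
    (hF : (G.fieldBound ω : ℕ∞) < ENat.card F) :
    ∃ k : ExtChan E ω → E → F, ∀ ξ : Finset E, ξ.Nonempty → ∀ ρ : Finset E,
      ρ.card = G.chanCutNum ξ - ω → ∃ J : Finset (Fin ω), J.card = min ω (G.chanCutNum ξ) ∧
        LinearIndepOn F (G.kerRow k ξ) (Sum.inl '' (J : Set (Fin ω))) ∧
        Disjoint (span F (G.kerRow k ξ '' (Sum.inl '' (J : Set (Fin ω)))))
          (span F (G.kerRow k ξ '' (Sum.inr '' (ρ : Set E)))) := by
  have hJ : ∀ ξ : Finset E, ∃ J : Finset (Fin ω), J.card = min ω (G.chanCutNum ξ) := by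
    intro ξ
    obtain ⟨J, -, hJ⟩ := Finset.exists_subset_card_eq (s := (Finset.univ : Finset (Fin ω)))
      (n := min ω (G.chanCutNum ξ)) (by simp)
    exact ⟨J, hJ⟩
  choose J hJ using hJ
  -- If $C_\xi<\omega$, the truncated difference pairs `ξ` with the empty pattern only.
  let s : Finset (Σ _ : Finset E, Finset E) := (Finset.univ.filter fun ξ => ξ.Nonempty).sigma
    fun ξ => Finset.univ.powersetCard (G.chanCutNum ξ - ω)
  have hs : s.card ≤ G.fieldBound ω := by
    refine le_trans (le_of_eq ?_) (G.sum_choose_le_fieldBound ω)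
    simp [s, Finset.card_sigma, Finset.card_powersetCard]
  have hP : ∀ x : Σ _ : Finset E, Finset E, ∃ P : MvPolynomial (ExtChan E ω × E) F,
      x ∈ s → P ≠ 0 ∧ (∀ v, P.degreeOf v ≤ 1) ∧
      ∀ k : ExtChan E ω → E → F, MvPolynomial.eval (fun v => k v.1 v.2) P ≠ 0 →
        LinearIndepOn F (G.kerRow k x.1) (Sum.inl '' (J x.1 : Set (Fin ω))) ∧
        Disjoint (span F (G.kerRow k x.1 '' (Sum.inl '' (J x.1 : Set (Fin ω)))))
          (span F (G.kerRow k x.1 '' (Sum.inr '' (x.2 : Set E)))) := by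
    rintro ⟨ξ, ρ⟩
    by_cases hx : (⟨ξ, ρ⟩ : Σ _ : Finset E, Finset E) ∈ s
    · have hρ : ρ.card = G.chanCutNum ξ - ω := by simpa using (Finset.mem_sigma.1 hx).2
      obtain ⟨P, hP⟩ := hh.exists_separating_polynomial F (ξ := ξ) (ρ := ρ) (J := J ξ)
        (by rw [hJ, hρ]; omega)
      exact ⟨P, fun _ => hP⟩
    · exact ⟨0, fun hx' => absurd hx' hx⟩
  choose P hP using hP
  obtain ⟨x, hx⟩ := MvPolynomial.exists_forall_eval_ne_zero s P (fun i hi => (hP i hi).1)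
    (fun i hi => (hP i hi).2.1) (lt_of_le_of_lt (by exact_mod_cast hs) hF)
  refine ⟨fun d e => x (d, e), fun ξ hξ ρ hρ => ⟨J ξ, hJ ξ, ?_⟩⟩
  have hmem : (⟨ξ, ρ⟩ : Σ _ : Finset E, Finset E) ∈ s := by simp [s, hξ, hρ]
  exact (hP _ hmem).2.2 _ (hx _ hmem)

theorem Network.IsHeight.exists_isGenericMDS (hh : G.IsHeight h)
    (hF : (G.fieldBound ω : ℕ∞) < ENat.card F) (hω : 1 ≤ ω) :
    ∃ K : LNECCode G F ω, K.IsGenericMDS := by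
  obtain ⟨k, hk⟩ := hh.exists_coeff hF
  have hmsg : ∀ ξ, (hh.code k).msgSpace ξ = span F (G.kerRow k ξ '' Set.range Sum.inl) := fun ξ => by
    rw [← Set.range_comp]; rfl
  have herr : ∀ ξ ρ, (hh.code k).errSpace ξ ρ =
      span F (G.kerRow k ξ '' (Sum.inr '' (ρ : Set E))) := fun ξ ρ => by
    rw [Set.image_image]; rfl
  have hle : ∀ ξ, ∃ A : Finset E, A.card = G.chanCutNum ξ ∧
      (hh.code k).msgSpace ξ ≤ (hh.code k).errSpace ξ A := by
    intro ξ
    obtain ⟨A, ⟨W, hs, hW⟩, hA⟩ := G.exists_isChanCut_card_eq ξ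
    refine ⟨A, hA, Submodule.span_le.2 ?_⟩
    rintro _ ⟨i, rfl⟩
    exact hh.kerRow_mem_span_of_isChanCut k hW (Sum.inl i) hs fun _ _ => Sum.inl_ne_inr
  have herrcard : ∀ ξ ρ : Finset E, Module.finrank F ((hh.code k).errSpace ξ ρ) ≤ ρ.card := by
    intro ξ ρ
    have h1 := finrank_span_finset_le_card (R := F) (ρ.image fun e => (hh.code k).row ξ (Sum.inr e))
    rw [Set.finrank, Finset.coe_image] at h1
    exact h1.trans Finset.card_image_le
  have hgen : ∀ ξ : Finset E, ξ.Nonempty →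
      Module.finrank F ((hh.code k).msgSpace ξ) = min ω (G.chanCutNum ξ) := by
    intro ξ hξ
    apply le_antisymm
    · refine le_min ?_ ?_
      · exact (finrank_range_le_card _).trans (by simp)
      · obtain ⟨A, hA, hAle⟩ := hle ξ
        exact (Submodule.finrank_mono hAle).trans ((herrcard ξ A).trans hA.le)
    · obtain ⟨ρ, -, hρ⟩ := Finset.exists_subset_card_eq (s := (Finset.univ : Finset E))
        (n := G.chanCutNum ξ - ω) ((Nat.sub_le _ _).trans
          ((G.chanCutNum_le_card ξ).trans (Finset.card_le_univ ξ)))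
      obtain ⟨J, hJ, hli, -⟩ := hk ξ hξ ρ hρ
      have h1 := finrank_span_eq_card (R := F)
        (b := fun x : (Sum.inl '' (J : Set (Fin ω)) : Set (ExtChan E ω)) => G.kerRow k ξ x) hli
      rw [← Nat.card_eq_fintype_card, Nat.card_coe_set_eq,
        Set.ncard_image_of_injective _ Sum.inl_injective, Set.ncard_coe_finset,
        ← Set.image_eq_range] at h1
      rw [← hJ, ← h1, hmsg]
      exact Submodule.finrank_mono (Submodule.span_mono (Set.image_mono (Set.image_subset_range _ _)))
  refine ⟨hh.code k, fun ξ hξ => by rw [chanMinCut_eq_chanCutNum, hgen ξ hξ], fun ξ hξ => ?_⟩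
  rw [chanMinCut_eq_chanCutNum]
  obtain ⟨A, hA, hAle⟩ := hle ξ
  constructor
  · intro hC
    apply le_antisymm
    -- The message space has dimension `ω`, so `ω - 1` channels of a minimum cut may be dropped.
    · obtain ⟨ρ, hρ, hne⟩ := exists_errSpace_inf_msgSpace_ne_bot (hh.code k) hAle (n := ω - 1)
        (by rw [hgen ξ hξ]; omega) (by omega)
      refine (iInf₂_le ρ hne).trans ?_
      exact_mod_cast (show ρ.card ≤ G.chanCutNum ξ - ω + 1 by omega)
    · refine le_iInf₂ fun ρ hne => ?_
      by_contra! hlt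
      have hlt' : ρ.card < G.chanCutNum ξ - ω + 1 := by exact_mod_cast hlt
      -- Only patterns of size exactly $C_\xi-\omega$ were treated; a smaller one is enlarged to
      -- that size.
      obtain ⟨ρ', hsub, hρ'⟩ := Finset.exists_superset_card_eq (s := ρ)
        (n := G.chanCutNum ξ - ω) (by omega) ((Nat.sub_le _ _).trans
          ((G.chanCutNum_le_card ξ).trans (Finset.card_le_univ ξ)))
      obtain ⟨J, hJ, -, hdis⟩ := hk ξ hξ ρ' hρ'
      have hJuniv : J = Finset.univ := by
        rw [← Finset.card_eq_iff_eq_univ, hJ, Fintype.card_fin]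
        omega
      rw [hJuniv, Finset.coe_univ, Set.image_univ, ← hmsg, ← herr] at hdis
      refine hne (le_bot_iff.1 ((inf_le_inf_right _ ?_).trans hdis.symm.le_bot))
      exact Submodule.span_mono (Set.image_mono (Finset.coe_subset.2 hsub))
  · intro hpos hlt
    have hrank : Module.finrank F ((hh.code k).msgSpace ξ) = G.chanCutNum ξ := by
      rw [hgen ξ hξ, min_eq_right hlt.le]
    apply le_antisymm
    -- The message space has the dimension of the whole cut, so all but one of its channels may be
    -- dropped.
    · obtain ⟨ρ, hρ, hne⟩ := exists_errSpace_inf_msgSpace_ne_bot (hh.code k) hAle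
        (n := G.chanCutNum ξ - 1) (by omega) (by omega)
      refine (iInf₂_le ρ hne).trans ?_
      exact_mod_cast (show ρ.card ≤ 1 by omega)
    · refine le_iInf₂ fun ρ hne => ?_
      rw [Order.one_le_iff_ne_zero, Nat.cast_ne_zero, Finset.card_ne_zero, Finset.nonempty_iff_ne_empty]
      rintro rfl
      exact hne (by simp [LNECCode.errSpace])

end Existence

theorem mainTheorem5 {V E F : Type*} [Fintype V] [Fintype E] [Field F]
    (G : Network V E) (hacyclic : G.Acyclic) (hsource : ∀ e, G.head e ≠ G.source)
    (ω : ℕ) (hω : 1 ≤ ω) (hF : (G.fieldBound ω : ℕ∞) < ENat.card F) :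
    ∃ K : LNECCode G F ω, K.IsGenericMDS := by
  obtain ⟨h, hh⟩ := hacyclic.exists_isHeight ω
  exact hh.exists_isGenericMDS hF hω
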